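/- Let $s\ge 1$, let $\mathbf M$ be an irreducible $s\times s$ matrix with entries in $\{0,1\}$ (for all $i,j$ there is $n\ge1$ with $(\mathbf M^n)(i,j)>0$), and fix $\lambda\in(0,1)$. Let $\Sigma=\{x=(x_0,x_1,\dots):\mathbf M(x_j,x_{j+1})=1\ \forall j\ge0\}$ be the one-sided subshift of finite type with the distance $d(x,x')=\lambda^{\min\{j:\,x_j\ne x'_j\}}$ (and $d(x,x)=0$), let $\Sigma^*=\{y=(\dots,y_2,y_1):\mathbf M(y_{j+1},y_j)=1\ \forall j\ge1\}$ with the analogous distance, and let $\hat\Sigma=\{(y,x)\in\Sigma^*\times\Sigma:\mathbf M(y_1,x_0)=1\}$ with the maximum of the two distances. Put $\pi(y,x)=x$ and $\tau(y,x)=(y_1,x_0,x_1,\dots)$. Let $A:\hat\Sigma\to\mathbb R$ be Hölder continuous. Let $\bar A=\min_{\hat\mu}\int A\,d\hat\mu$ over all Borel probability measures $\hat\mu$ on $\hat\Sigma$ that are holonomic, i.e. $\int f\circ\tau\,d\hat\mu=\int f\circ\pi\,d\hat\mu$ for all continuous $f:\Sigma\to\mathbb R$. A continuous $u:\Sigma\to\mathbb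 R$ is a sub-action if $u(\pi(z))-u(\tau(z))\le A(z)-\bar A$ for all $z\in\hat\Sigma$; a sub-action $u$ is calibrated if $u(x)=\min_{z\in\hat\Sigma,\ \pi(z)=x}\,[u(\tau(z))+A(z)-\bar A]$ for all $x\in\Sigma$. For $x,x'\in\Sigma$, $\varepsilon>0$ and $k\ge1$ let $\mathcal P_k(x,x',\varepsilon)$ be the set of all $(z^0,\dots,z^k)\in\hat\Sigma^{k+1}$ with $\pi(z^{i})=\tau(z^{i+1})$ for $0\le i<k$, $d(\pi(z^0),x)<\varepsilon$ and $d(\pi(z^k),x')<\varepsilon$. Let $\Omega(A)$ be the set of all $x\in\Sigma$ such that for every $\varepsilon>0$ there are $k\ge1$ and $(z^0,\dots,z^k)\in\mathcal P_k(x,x,\varepsilon)$ with $\bigl|\sum_{i=1}^k(A(z^i)-\bar A)\bigr|<\varepsilon$. The Peierls barrier is $$h_A(x,x')=\lim_{\varepsilon\to0}\ \liminf_{k\to\infty}\ \inf\Bigl\{\sum_{i=1}^k(A(z^i)-\bar A)\ :\ (z^0,\dots,z^k)\in\mathcal P_k(x,x',\varepsilon)\Bigr\},\qquad \inf\emptyset=+\infty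 .$$ The irreducible components are the equivalence classes in $\Omega(A)$ of the relation $h_A(x,x')+h_A(x',x)=0$. Let $v$ be a continuous sub-action and $u$ a continuous calibrated sub-action for $A$. Then: 1. $u-v$ is constant on every irreducible component, the minima of $u-v$ over $\Sigma$ and over $\Omega(A)$ exist, and $\min_\Sigma(u-v)=\min_{\Omega(A)}(u-v)$. 2. Suppose that $\Omega(A)=C_1\sqcup\dots\sqcup C_r$ is a finite union of disjoint irreducible components, that $C_{i_1}$ is the only one of these components on which $\min_\Sigma(u-v)$ is attained, and that no $C_i$ with $i\ne i_1$ is a local minimum of $u-v$, i.e. every neighbourhood of $C_i$ contains a point at which $u-v$ is smaller than its constant value on $C_i$. Then for every $\bar x\in C_{i_1}$, $$u(x)=u(\bar x)+h_A(\bar x,x)\qquad\text{for all }x\in\Sigma .$$ -/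

import Mathlib

open Filter Topology MeasureTheory

namespace SFT

/-- `M` is a `0`-`1` matrix. -/
def IsTransitionMatrix {s : ℕ} (M : Matrix (Fin s) (Fin s) ℕ) : Prop :=
  ∀ i j, M i j = 0 ∨ M i j = 1

/-- Every state can be reached from every state in a positive number of steps. -/
def IsIrreducible {s : ℕ} (M : Matrix (Fin s) (Fin s) ℕ) : Prop :=
  ∀ i j, ∃ n : ℕ, 1 ≤ n ∧ 0 < (M ^ n) i j

/-- The one-sided subshift of finite type `Σ`; its points are `(x₀, x₁, …)`.  It carries the
topology (and the Borel σ-algebra) of a subspace of the product of discrete spaces. -/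
abbrev Shift {s : ℕ} (M : Matrix (Fin s) (Fin s) ℕ) : Type :=
  {x : ℕ → Fin s // ∀ j, M (x j) (x (j + 1)) = 1}

/-- The dual subshift `Σ*`; its points are the pasts `(…, y₃, y₂, y₁)`, and the letter `y_{j+1}`
is stored at the index `j`. -/
abbrev Dual {s : ℕ} (M : Matrix (Fin s) (Fin s) ℕ) : Type :=
  {y : ℕ → Fin s // ∀ j, M (y (j + 1)) (y j) = 1}

/-- The natural extension: the pairs `(y, x) = (…, y₂, y₁ | x₀, x₁, …)` with `M(y₁, x₀) = 1`. -/
abbrev NatExt {s : ℕ} (M : Matrix (Fin s) (Fin s) ℕ) : Type :=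
  {z : Dual M × Shift M // M (z.1.1 0) (z.2.1 0) = 1}

variable {s : ℕ} {M : Matrix (Fin s) (Fin s) ℕ}

/-- The σ-algebra of the natural extension is its Borel σ-algebra. -/
instance instBorelSpaceNatExt : BorelSpace (NatExt M) := by
  have : SecondCountableTopology (Fin s) := DiscreteTopology.secondCountableTopology_of_countable
  have : SecondCountableTopology (Shift M) :=
    TopologicalSpace.Subtype.secondCountableTopology _
  exact Subtype.borelSpace {z : Dual M × Shift M | M (z.1.1 0) (z.2.1 0) = 1}

/-- The canonical projection `π(y, x) = x`. -/
def proj (z : NatExt M) : Shift M := z.1.2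

/-- The inverse branch `τ(y, x) = τ_y(x) = (y₁, x₀, x₁, …)`. -/
def tau (z : NatExt M) : Shift M :=
  ⟨fun n => Nat.casesOn n (z.1.1.1 0) z.1.2.1, fun j => by
    cases j with
    | zero => exact z.2
    | succ k => exact z.1.2.2 k⟩

/-- `lam ^ k` where `k` is the first index at which the two sequences differ, and `0` if they
are equal. -/
noncomputable def seqDist (lam : ℝ) (x x' : ℕ → Fin s) : ℝ :=
  open Classical in if x = x' then 0 else lam ^ PiNat.firstDiff x x'

/-- The distance of `Σ`. -/
noncomputable def shiftDist (lam : ℝ) (x x' : Shift M) : ℝ := seqDist lam x.1 x'.1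

/-- The distance of the natural extension, as a subset of the product `Σ* × Σ`. -/
noncomputable def natExtDist (lam : ℝ) (z z' : NatExt M) : ℝ :=
  max (seqDist lam z.1.1.1 z'.1.1.1) (seqDist lam z.1.2.1 z'.1.2.1)

/-- `A` is Hölder continuous (with some positive exponent). -/
def IsHolder (lam : ℝ) (A : NatExt M → ℝ) : Prop :=
  ∃ θ : ℝ, 0 < θ ∧ ∃ K : ℝ, ∀ z z', |A z - A z'| ≤ K * natExtDist lam z z' ^ θ

/-- Holonomic probability measures on the natural extension. -/
def IsHolonomic (μ : Measure (NatExt M)) : Prop :=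
  IsProbabilityMeasure μ ∧
    ∀ f : Shift M → ℝ, Continuous f → ∫ z, f (tau z) ∂μ = ∫ z, f (proj z) ∂μ

/-- The holonomic minimizing value `Ā`. -/
noncomputable def minValue (A : NatExt M → ℝ) : ℝ :=
  sInf {a | ∃ μ : Measure (NatExt M), IsHolonomic μ ∧ a = ∫ z, A z ∂μ}

/-- `u` is a continuous sub-action for `A`. -/
def IsSubaction (A : NatExt M → ℝ) (u : Shift M → ℝ) : Prop :=
  Continuous u ∧ ∀ z, u (proj z) - u (tau z) ≤ A z - minValue A

/-- `u` is a continuous calibrated sub-action for `A`: for every `x`, the value `u x` is the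
minimum of `u (τ_y x) + A (y, x) - Ā` over all `y` with `(y, x)` in the natural extension. -/
def IsCalibrated (A : NatExt M → ℝ) (u : Shift M → ℝ) : Prop :=
  IsSubaction A u ∧
    ∀ x, IsLeast {a | ∃ z : NatExt M, proj z = x ∧ a = u (tau z) + A z - minValue A} (u x)

/-- `(z⁰, …, z^k)` is a path that begins within `ε` of `x` and ends within `ε` of `x'`. -/
def IsPath (lam : ℝ) (k : ℕ) (x x' : Shift M) (ε : ℝ) (z : Fin (k + 1) → NatExt M) : Prop :=
  (∀ i : Fin k, proj (z i.castSucc) = tau (z i.succ)) ∧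
    shiftDist lam (proj (z 0)) x < ε ∧ shiftDist lam (proj (z (Fin.last k))) x' < ε

/-- The sum of `A - Ā` over `z¹, …, z^k`. -/
noncomputable def action (A : NatExt M → ℝ) (k : ℕ) (z : Fin (k + 1) → NatExt M) : ℝ :=
  ∑ i : Fin k, (A (z i.succ) - minValue A)

/-- The set `Ω(A)` of non-wandering points with respect to `A`. -/
def nonwandering (lam : ℝ) (A : NatExt M → ℝ) : Set (Shift M) :=
  {x | ∀ ε : ℝ, 0 < ε → ∃ k : ℕ, 1 ≤ k ∧ ∃ z : Fin (k + 1) → NatExt M,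
    IsPath lam k x x ε z ∧ |action A k z| < ε}

/-- The infimum of the actions of the paths of length `k` that begin within `ε` of `x` and end
within `ε` of `x'` (it is `+∞` if there is no such path). -/
noncomputable def minAction (lam : ℝ) (A : NatExt M → ℝ) (ε : ℝ) (x x' : Shift M) (k : ℕ) :
    EReal :=
  ⨅ (z : Fin (k + 1) → NatExt M) (_ : IsPath lam k x x' ε z), (action A k z : EReal)

/-- The Peierls barrier `h_A(x, x')`.  The lower limit increases as `ε` decreases, so that its
limit for `ε → 0` is the supremum over `ε > 0` (see `tendsto_peierls`). -/
noncomputable def peierls (lam : ℝ) (A : NatExt M → ℝ) (x x' : Shift M) : EReal :=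
  ⨆ (ε : ℝ) (_ : 0 < ε), liminf (fun k => minAction lam A ε x x' k) atTop

theorem tendsto_peierls (lam : ℝ) (A : NatExt M → ℝ) (x x' : Shift M) :
    Tendsto (fun ε : ℝ => liminf (fun k => minAction lam A ε x x' k) atTop) (𝓝[>] 0)
      (𝓝 (peierls lam A x x')) := by
  have hanti : Antitone fun ε : ℝ => liminf (fun k => minAction lam A ε x x' k) atTop := by
    intro ε ε' hle
    refine liminf_le_liminf (Eventually.of_forall fun k => ?_)
    refine le_iInf₂ fun z hz => iInf₂_le z ?_
    exact ⟨hz.1, hz.2.1.trans_le hle, hz.2.2.trans_le hle⟩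
  rw [tendsto_order]
  constructor
  · intro a ha
    obtain ⟨ε, hε⟩ := lt_iSup_iff.1 ha
    obtain ⟨hpos, hε⟩ := lt_iSup_iff.1 hε
    filter_upwards [Ioo_mem_nhdsGT hpos] with ε' hε'
    exact hε.trans_le (hanti hε'.2.le)
  · intro a ha
    filter_upwards [self_mem_nhdsWithin] with ε hε
    exact (le_iSup₂ (f := fun (ε : ℝ) (_ : 0 < ε) =>
      liminf (fun k => minAction lam A ε x x' k) atTop) ε hε).trans_lt ha

/-- `C` is an irreducible component: an equivalence class in `Ω(A)` of the relation
`h_A(x, x') + h_A(x', x) = 0`. -/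
def IsComponent (lam : ℝ) (A : NatExt M → ℝ) (C : Set (Shift M)) : Prop :=
  ∃ x ∈ nonwandering lam A,
    C = {x' ∈ nonwandering lam A | peierls lam A x x' + peierls lam A x' x = 0}

/-- The set `C` is a local minimum of `f`: on some neighbourhood of `C`, the function `f` is
nowhere smaller than on `C`. -/
def IsLocalMinSet (f : Shift M → ℝ) (C : Set (Shift M)) : Prop :=
  ∃ U : Set (Shift M), IsOpen U ∧ C ⊆ U ∧ ∀ x ∈ C, ∀ x' ∈ U, f x ≤ f x'

end SFT

/-!
Every sub-action `u` satisfies `u x' - u x ≤ h_A(x, x')`; call `p` a source of `x` when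
`u x - u p = h_A(p, x)`.  Shadowing gives the triangle inequality for `h_A`, so being a source is a
transitive relation, and comparison with the inequality for `v` shows that `u - v` is at least as
large at `x` as at its sources.  Points of one irreducible component are sources of each other,
hence `u - v` is constant there.  If `u` is calibrated, following minimizing branches backwards
from `x` produces an orbit along which that inequality is an equality; its cluster points are
non-wandering sources of `x`, which puts the minimum of `u - v` on `Ω(A)`.

With finitely many components, choose a component `C` that consists of sources of `x` and has the
least value of `u - v` among such components.  The points with a source in a component of smaller
value form a closed set, and by transitivity `C` misses it; on the complement `u - v` is at least
its value on `C`.  So `C` is a local minimum, which forces `C = C_{i₁}`.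
-/

namespace SFT

variable {s : ℕ} {M : Matrix (Fin s) (Fin s) ℕ}

section Topology

variable {lam : ℝ}

theorem seqDist_nonneg (h0 : 0 < lam) (x x' : ℕ → Fin s) : 0 ≤ seqDist lam x x' := by
  unfold seqDist
  split_ifs <;> positivity

theorem seqDist_le_pow_iff (h0 : 0 < lam) (h1 : lam < 1) {n : ℕ} {x x' : ℕ → Fin s} :
    seqDist lam x x' ≤ lam ^ n ↔ x ∈ PiNat.cylinder x' n := by
  unfold seqDist
  split_ifs with h
  · simp [h, h0.le]
  · rw [pow_le_pow_iff_right_of_lt_one₀ h0 h1, PiNat.mem_cylinder_iff_le_firstDiff h]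

theorem hasBasis_nhds_cylinder (x : Shift M) :
    (𝓝 x).HasBasis (fun _ : ℕ => True) fun n => {y | y.1 ∈ PiNat.cylinder x.1 n} := by
  refine ⟨fun U => ⟨fun hU => ?_, fun ⟨n, _, hn⟩ => mem_of_superset ?_ hn⟩⟩
  · obtain ⟨V, hV, hVU⟩ := mem_nhds_subtype _ _ _ |>.1 hU
    obtain ⟨_, ⟨y, n, rfl⟩, hxy, hyV⟩ :=
      (PiNat.isTopologicalBasis_cylinders fun _ : ℕ => Fin s).mem_nhds_iff.1 hV
    rw [← PiNat.mem_cylinder_iff_eq.1 hxy] at hyV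
    exact ⟨n, trivial, fun y hy => hVU (hyV hy)⟩
  · exact ((PiNat.isOpen_cylinder _ x.1 n).preimage continuous_subtype_val).mem_nhds
      (PiNat.self_mem_cylinder x.1 n)

theorem eventually_mem_cylinder (n : ℕ) (x : Shift M) :
    ∀ᶠ y in 𝓝 x, y.1 ∈ PiNat.cylinder x.1 n :=
  (hasBasis_nhds_cylinder x).mem_of_mem trivial

theorem exists_cylinder_abs_sub_lt {f : Shift M → ℝ} (hf : Continuous f) (x : Shift M) {δ : ℝ}
    (hδ : 0 < δ) : ∃ n, ∀ y : Shift M, y.1 ∈ PiNat.cylinder x.1 n → |f y - f x| < δ := by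
  have hnear : ∀ᶠ y in 𝓝 x, |f y - f x| < δ := Metric.tendsto_nhds.1 hf.continuousAt δ hδ
  simpa using (hasBasis_nhds_cylinder x).eventually_iff.1 hnear

instance instCompactSpaceShift : CompactSpace (Shift M) := by
  refine isCompact_iff_compactSpace.1 (IsClosed.isCompact ?_)
  change IsClosed {x : ℕ → Fin s | ∀ j, M (x j) (x (j + 1)) = 1}
  rw [Set.ofPred_forall]
  refine isClosed_iInter fun j => ?_
  have hcont : Continuous fun x : ℕ → Fin s => (x j, x (j + 1)) := by fun_prop
  exact (isClosed_discrete {p : Fin s × Fin s | M p.1 p.2 = 1}).preimage hcont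

theorem IsIrreducible.exists_eq_one (hirr : IsIrreducible M) (hM : IsTransitionMatrix M)
    (i : Fin s) : ∃ j, M i j = 1 := by
  obtain ⟨n, hn, hpos⟩ := hirr i i
  obtain ⟨m, rfl⟩ := Nat.exists_eq_add_of_le' hn
  rw [pow_succ', Matrix.mul_apply] at hpos
  obtain ⟨j, -, hj⟩ := Finset.exists_ne_zero_of_sum_ne_zero hpos.ne'
  exact ⟨j, (hM i j).resolve_left (left_ne_zero_of_mul hj)⟩

theorem nonempty_shift (hs : 1 ≤ s) (hsucc : ∀ i, ∃ j, M i j = 1) : Nonempty (Shift M) := by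
  choose next hnext using hsucc
  refine ⟨⟨fun n => next^[n] ⟨0, hs⟩, fun j => ?_⟩⟩
  simp only [Function.iterate_succ_apply']
  exact hnext _

end Topology

section Paths

variable {lam : ℝ} {A : NatExt M → ℝ}

/-- `HasPath A k x x' a`: some path `(z⁰, …, z^k)` with `π(z⁰) = x` and `π(z^k) = x'` has action
`a`.  Growing paths at their far end makes concatenation and shadowing structural inductions. -/
inductive HasPath (A : NatExt M → ℝ) : ℕ → Shift M → Shift M → ℝ → Prop
  | start (z : NatExt M) : HasPath A 0 (proj z) (proj z) 0
  | step {k : ℕ} {x : Shift M} {a : ℝ} (z : NatExt M) (h : HasPath A k x (tau z) a) :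
      HasPath A (k + 1) x (proj z) (a + (A z - minValue A))

theorem HasPath.trans {k l : ℕ} {x x' x'' : Shift M} {a b : ℝ} (h : HasPath A k x x' a)
    (h' : HasPath A l x' x'' b) : HasPath A (k + l) x x'' (a + b) := by
  induction h' with
  | start z => simpa using h
  | step z _ ih => simpa only [add_assoc] using (ih h).step z

theorem action_succ {k : ℕ} (z : Fin (k + 2) → NatExt M) :
    action A (k + 1) z =
      action A k (fun i => z i.castSucc) + (A (z (Fin.last (k + 1))) - minValue A) :=
  Fin.sum_univ_castSucc _

theorem hasPath_action {k : ℕ} {z : Fin (k + 1) → NatExt M}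
    (hz : ∀ i : Fin k, proj (z i.castSucc) = tau (z i.succ)) :
    HasPath A k (proj (z 0)) (proj (z (Fin.last k))) (action A k z) := by
  induction k with
  | zero => simpa [action] using HasPath.start (A := A) (z 0)
  | succ k ih =>
    have h := ih (z := fun i => z i.castSucc) fun i => hz i.castSucc
    rw [hz (Fin.last k)] at h
    rw [action_succ]
    exact h.step _

theorem HasPath.exists_action_eq {k : ℕ} {x x' : Shift M} {a : ℝ} (h : HasPath A k x x' a) :
    ∃ z : Fin (k + 1) → NatExt M, (∀ i : Fin k, proj (z i.castSucc) = tau (z i.succ)) ∧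
      proj (z 0) = x ∧ proj (z (Fin.last k)) = x' ∧ action A k z = a := by
  induction h with
  | start z => exact ⟨fun _ => z, fun i => i.elim0, rfl, rfl, by simp [action]⟩
  | @step k x a w _ ih =>
    obtain ⟨z, hz, h0, hlast, rfl⟩ := ih
    refine ⟨Fin.snoc z w, fun i => ?_, ?_, ?_, ?_⟩
    · induction i using Fin.lastCases with
      | last => simpa using hlast
      | cast i => simpa only [Fin.succ_castSucc, Fin.snoc_castSucc] using hz i
    · rw [← Fin.castSucc_zero, Fin.snoc_castSucc, h0]
    · simp
    · simp only [action_succ, Fin.snoc_castSucc, Fin.snoc_last]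

theorem exists_isPath_iff {k : ℕ} {x x' : Shift M} {ε : ℝ} {P : ℝ → Prop} :
    (∃ z, IsPath lam k x x' ε z ∧ P (action A k z)) ↔
      ∃ y y' a, HasPath A k y y' a ∧ shiftDist lam y x < ε ∧ shiftDist lam y' x' < ε ∧ P a := by
  constructor
  · rintro ⟨z, ⟨hz, hx, hx'⟩, hP⟩
    exact ⟨_, _, _, hasPath_action hz, hx, hx', hP⟩
  · rintro ⟨y, y', a, h, hx, hx', hP⟩
    obtain ⟨z, hz, rfl, rfl, rfl⟩ := h.exists_action_eq
    exact ⟨z, ⟨hz, hx, hx'⟩, hP⟩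

theorem minAction_lt_iff {k : ℕ} {x x' : Shift M} {ε : ℝ} {c : EReal} :
    minAction lam A ε x x' k < c ↔ ∃ y y' a, HasPath A k y y' a ∧
      shiftDist lam y x < ε ∧ shiftDist lam y' x' < ε ∧ (a : EReal) < c := by
  simp only [minAction, iInf_lt_iff, exists_prop]
  exact exists_isPath_iff (P := fun a : ℝ => (a : EReal) < c)

theorem peierls_le_coe_iff (h0 : 0 < lam) (h1 : lam < 1) {x x' : Shift M} {a : ℝ} :
    peierls lam A x x' ≤ a ↔ ∀ n N : ℕ, ∀ δ > 0, ∃ k ≥ N, ∃ y y' b, HasPath A k y y' b ∧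
      y.1 ∈ PiNat.cylinder x.1 n ∧ y'.1 ∈ PiNat.cylinder x'.1 n ∧ b < a + δ := by
  unfold peierls
  have hlim (ε : ℝ) := liminf_le_iff (f := atTop) (x := (a : EReal))
    (u := fun k => minAction lam A ε x x' k)
  simp only [iSup_le_iff, hlim, Filter.frequently_atTop, minAction_lt_iff]
  constructor
  · intro h n N δ hδ
    obtain ⟨k, hk, y, y', b, hyy', hy, hy', hb⟩ := h (lam ^ n) (by positivity) ((a + δ : ℝ) : EReal)
      (EReal.coe_lt_coe_iff.2 (by linarith)) N
    exact ⟨k, hk, y, y', b, hyy', (seqDist_le_pow_iff h0 h1).1 hy.le,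
      (seqDist_le_pow_iff h0 h1).1 hy'.le, EReal.coe_lt_coe_iff.1 hb⟩
  · intro h ε hε c hc N
    obtain ⟨b, hab, hbc⟩ := EReal.lt_iff_exists_real_btwn.1 hc
    obtain ⟨n, hn⟩ := exists_pow_lt_of_lt_one hε h1
    obtain ⟨k, hk, y, y', d, hyy', hy, hy', hd⟩ :=
      h n N (b - a) (sub_pos.2 (EReal.coe_lt_coe_iff.1 hab))
    refine ⟨k, hk, y, y', d, hyy', ((seqDist_le_pow_iff h0 h1).2 hy).trans_lt hn,
      ((seqDist_le_pow_iff h0 h1).2 hy').trans_lt hn, lt_trans ?_ hbc⟩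
    exact EReal.coe_lt_coe_iff.2 (by linarith)

end Paths

section Variation

variable {lam : ℝ} {A : NatExt M → ℝ}

/-- `φ n` bounds the oscillation of `A` over any set of points whose pasts share their last `n`
letters and whose futures share their first `n` letters. -/
def IsVariationBound (A : NatExt M → ℝ) (φ : ℕ → ℝ) : Prop :=
  ∀ n, ∀ z z' : NatExt M, z.1.1.1 ∈ PiNat.cylinder z'.1.1.1 n →
    z.1.2.1 ∈ PiNat.cylinder z'.1.2.1 n → |A z - A z'| ≤ φ n

/-- Summable variations: the regularity, weaker than Hölder continuity, that makes the actions of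
paths staying close to each other comparable independently of their length. -/
def HasSummableVariation (A : NatExt M → ℝ) : Prop :=
  ∃ φ : ℕ → ℝ, Summable φ ∧ IsVariationBound A φ

theorem IsHolder.hasSummableVariation (h0 : 0 < lam) (h1 : lam < 1) (hA : IsHolder lam A) :
    HasSummableVariation A := by
  obtain ⟨θ, hθ, K, hK⟩ := hA
  refine ⟨fun n => |K| * (lam ^ θ) ^ n, (summable_geometric_of_lt_one (Real.rpow_nonneg h0.le θ)
    (Real.rpow_lt_one h0.le h1 hθ)).mul_left _, fun n z z' hpast hfuture => ?_⟩
  have hdist : natExtDist lam z z' ≤ lam ^ n :=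
    max_le ((seqDist_le_pow_iff h0 h1).2 hpast) ((seqDist_le_pow_iff h0 h1).2 hfuture)
  have hdist_nonneg : 0 ≤ natExtDist lam z z' := le_max_of_le_left (seqDist_nonneg h0 _ _)
  calc |A z - A z'| ≤ K * natExtDist lam z z' ^ θ := hK z z'
    _ ≤ |K| * (lam ^ n) ^ θ := by gcongr; exact le_abs_self K
    _ = |K| * (lam ^ θ) ^ n := by rw [Real.rpow_pow_comm h0.le]

/-- The point of the natural extension with the past of `z` and the future `w`; it selects the
inverse branch applied along a shadowing path. -/
def replaceFuture (z : NatExt M) (w : Shift M) (h : w.1 0 = (proj z).1 0) : NatExt M :=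
  ⟨(z.1.1, w), h ▸ z.2⟩

theorem tau_replaceFuture_mem_cylinder {n : ℕ} {z : NatExt M} {w : Shift M}
    (h : w.1 0 = (proj z).1 0) (hw : w.1 ∈ PiNat.cylinder (proj z).1 n) :
    (tau (replaceFuture z w h)).1 ∈ PiNat.cylinder (tau z).1 (n + 1) := by
  rintro (_ | i) hi
  · rfl
  · exact hw i (Nat.lt_of_succ_lt_succ hi)

/-- Following `w` backwards along the inverse branches of the given path gains one letter of
agreement per step, so that the errors form the tail of a convergent series. -/
theorem HasPath.exists_shadowing {φ : ℕ → ℝ} (hφ : Summable φ) (hA : IsVariationBound A φ)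
    {k : ℕ} {x x' : Shift M} {a : ℝ} (h : HasPath A k x x' a) {n : ℕ} (hn : 0 < n)
    {w : Shift M} (hw : w.1 ∈ PiNat.cylinder x'.1 n) :
    ∃ y b, HasPath A k y w b ∧ y.1 ∈ PiNat.cylinder x.1 n ∧ b ≤ a + ∑' i, φ (i + n) := by
  have hφ_nonneg (z : NatExt M) (m : ℕ) : 0 ≤ φ m :=
    (abs_nonneg _).trans (hA m z z (PiNat.self_mem_cylinder _ m) (PiNat.self_mem_cylinder _ m))
  induction h generalizing n w with
  | start z =>
    refine ⟨w, 0, .start (replaceFuture z w (hw 0 hn)), hw, ?_⟩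
    simpa using tsum_nonneg fun i => hφ_nonneg z (i + n)
  | @step k x a z _ ih =>
    set z' := replaceFuture z w (hw 0 hn)
    obtain ⟨y, b, hyb, hy, hb⟩ := ih n.succ_pos (tau_replaceFuture_mem_cylinder (hw 0 hn) hw)
    refine ⟨y, _, hyb.step z', PiNat.cylinder_anti _ n.le_succ hy, ?_⟩
    have hlast : A z' - A z ≤ φ n :=
      (abs_le.1 (hA n z' z (PiNat.self_mem_cylinder _ n) hw)).2
    have htail : ∑' i, φ (i + n) = φ n + ∑' i, φ (i + (n + 1)) := by
      rw [((summable_nat_add_iff n).2 hφ).tsum_eq_zero_add]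
      simp only [zero_add, add_right_comm _ 1 n, add_assoc]
    linarith

theorem peierls_le_add_of_le (h0 : 0 < lam) (h1 : lam < 1) (hA : HasSummableVariation A)
    {x x' x'' : Shift M} {a b : ℝ} (ha : peierls lam A x x' ≤ a) (hb : peierls lam A x' x'' ≤ b) :
    peierls lam A x x'' ≤ (a + b : ℝ) := by
  obtain ⟨φ, hφ, hAφ⟩ := hA
  rw [peierls_le_coe_iff h0 h1] at ha hb ⊢
  intro n N δ hδ
  obtain ⟨m, htail, hm⟩ :=
    (((tendsto_sum_nat_add φ).eventually_lt_const (show 0 < δ / 3 by positivity)).and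
      (eventually_ge_atTop (n + 1))).exists
  obtain ⟨k, hk, y, y', c, hyy', hy, hy', hc⟩ := ha m N (δ / 3) (by positivity)
  obtain ⟨l, -, w, w', d, hww', hw, hw', hd⟩ := hb m 0 (δ / 3) (by positivity)
  have hwy' : w.1 ∈ PiNat.cylinder y'.1 m := by
    rwa [PiNat.mem_cylinder_iff_eq.1 hy']
  obtain ⟨p, e, hpw, hp, he⟩ := hyy'.exists_shadowing hφ hAφ (by omega) hwy'
  rw [PiNat.mem_cylinder_iff_eq.1 hy] at hp
  exact ⟨k + l, by omega, p, w', e + d, hpw.trans hww', PiNat.cylinder_anti _ (by omega) hp,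
    PiNat.cylinder_anti _ (by omega) hw', by linarith⟩

end Variation

section Sources

variable {lam : ℝ} {A : NatExt M → ℝ} {u v : Shift M → ℝ}

/-- `p` is a source of `x` for `u`: the bound `u x ≤ u p + h_A(p, x)`, valid for every sub-action
`u`, is an equality. -/
def IsSource (lam : ℝ) (A : NatExt M → ℝ) (u : Shift M → ℝ) (p x : Shift M) : Prop :=
  (u x : EReal) = u p + peierls lam A p x

theorem IsSubaction.sub_le_of_hasPath (hu : IsSubaction A u) {k : ℕ} {x x' : Shift M} {a : ℝ}
    (h : HasPath A k x x' a) : u x' - u x ≤ a := by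
  induction h with
  | start z => simp
  | step z _ ih => linarith [hu.2 z]

theorem IsSubaction.sub_le_peierls (h0 : 0 < lam) (h1 : lam < 1) (hu : IsSubaction A u)
    (x x' : Shift M) : ((u x' - u x : ℝ) : EReal) ≤ peierls lam A x x' := by
  refine EReal.le_of_forall_lt_iff_le.1 fun a ha => EReal.coe_le_coe_iff.2 ?_
  refine le_of_forall_pos_le_add fun δ hδ => ?_
  obtain ⟨m, hm⟩ := exists_cylinder_abs_sub_lt hu.1 x (δ := δ / 3) (by positivity)
  obtain ⟨m', hm'⟩ := exists_cylinder_abs_sub_lt hu.1 x' (δ := δ / 3) (by positivity)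
  obtain ⟨_, -, y, y', b, hyy', hy, hy', hb⟩ :=
    (peierls_le_coe_iff h0 h1).1 ha.le (max m m') 0 (δ / 3) (by positivity)
  have hyx := abs_lt.1 (hm y (PiNat.cylinder_anti _ (le_max_left m m') hy))
  have hyx' := abs_lt.1 (hm' y' (PiNat.cylinder_anti _ (le_max_right m m') hy'))
  linarith [hu.sub_le_of_hasPath hyy']

theorem IsSubaction.isSource_iff (h0 : 0 < lam) (h1 : lam < 1) (hu : IsSubaction A u)
    {p x : Shift M} : IsSource lam A u p x ↔ peierls lam A p x ≤ (u x - u p : ℝ) := by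
  have hle := hu.sub_le_peierls h0 h1 p x
  unfold IsSource
  generalize peierls lam A p x = h at *
  induction h with
  | bot => exact absurd (le_bot_iff.1 hle) (EReal.coe_ne_bot _)
  | top => simp [-EReal.coe_sub]
  | coe h =>
    norm_cast at hle ⊢
    constructor <;> intro <;> linarith

theorem IsSource.trans (h0 : 0 < lam) (h1 : lam < 1) (hA : HasSummableVariation A)
    (hu : IsSubaction A u) {p q x : Shift M} (hpq : IsSource lam A u p q)
    (hqx : IsSource lam A u q x) : IsSource lam A u p x := by
  rw [hu.isSource_iff h0 h1] at *
  simpa using peierls_le_add_of_le h0 h1 hA hpq hqx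

theorem IsSource.sub_le_sub (h0 : 0 < lam) (h1 : lam < 1) (hu : IsSubaction A u)
    (hv : IsSubaction A v) {p x : Shift M} (h : IsSource lam A u p x) :
    u p - v p ≤ u x - v x := by
  have hle : v x - v p ≤ u x - u p := EReal.coe_le_coe_iff.1 <|
    (hv.sub_le_peierls h0 h1 p x).trans ((hu.isSource_iff h0 h1).1 h)
  linarith

theorem IsSubaction.isClosed_setOf_isSource (h0 : 0 < lam) (h1 : lam < 1) (hu : IsSubaction A u)
    (p : Shift M) : IsClosed {x | IsSource lam A u p x} := by
  refine isClosed_of_closure_subset fun x hx => ?_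
  rw [Set.mem_ofPred_eq, hu.isSource_iff h0 h1, peierls_le_coe_iff h0 h1]
  intro n N δ hδ
  have hnear : ∀ᶠ x' in 𝓝 x, x'.1 ∈ PiNat.cylinder x.1 n ∧ u x' < u x + δ / 2 :=
    (eventually_mem_cylinder n x).and
      (hu.1.continuousAt.eventually_lt_const (by linarith))
  obtain ⟨x', ⟨hx'n, hx'u⟩, hx'⟩ := mem_closure_iff_nhds.1 hx _ hnear
  rw [Set.mem_ofPred_eq, hu.isSource_iff h0 h1, peierls_le_coe_iff h0 h1] at hx'
  obtain ⟨k, hk, y, y', b, hyy', hy, hy', hb⟩ := hx' n N (δ / 2) (by positivity)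
  rw [PiNat.mem_cylinder_iff_eq.1 hx'n] at hy'
  exact ⟨k, hk, y, y', b, hyy', hy, hy', by linarith⟩

theorem le_coe_neg_of_add_eq_zero {e f : EReal} {t : ℝ} (ht : (t : EReal) ≤ f)
    (hef : e + f = 0) : e ≤ (-t : ℝ) := by
  have hle : e + t ≤ 0 := (add_le_add_right ht e).trans_eq hef
  rw [← EReal.le_sub_iff_add_le (.inl (EReal.coe_ne_bot t)) (.inl (EReal.coe_ne_top t))] at hle
  simpa using hle

theorem IsComponent.exists_isSource (h0 : 0 < lam) (h1 : lam < 1) (hu : IsSubaction A u)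
    {C : Set (Shift M)} (hC : IsComponent lam A C) :
    ∃ b, ∀ p ∈ C, IsSource lam A u b p ∧ IsSource lam A u p b := by
  obtain ⟨b, -, rfl⟩ := hC
  refine ⟨b, fun p hp => ?_⟩
  rw [hu.isSource_iff h0 h1, hu.isSource_iff h0 h1]
  have hbp := le_coe_neg_of_add_eq_zero (hu.sub_le_peierls h0 h1 p b) hp.2
  have hpb := le_coe_neg_of_add_eq_zero (hu.sub_le_peierls h0 h1 b p) (add_comm _ _ |>.trans hp.2)
  rw [neg_sub] at hbp hpb
  exact ⟨hbp, hpb⟩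

theorem IsComponent.sub_eq_sub (h0 : 0 < lam) (h1 : lam < 1) (hu : IsSubaction A u)
    (hv : IsSubaction A v) {C : Set (Shift M)} (hC : IsComponent lam A C) {x x' : Shift M}
    (hx : x ∈ C) (hx' : x' ∈ C) : u x - v x = u x' - v x' := by
  obtain ⟨b, hb⟩ := hC.exists_isSource h0 h1 hu
  have hconst {p : Shift M} (hp : p ∈ C) : u p - v p = u b - v b :=
    le_antisymm ((hb p hp).2.sub_le_sub h0 h1 hu hv) ((hb p hp).1.sub_le_sub h0 h1 hu hv)
  rw [hconst hx, hconst hx']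

end Sources

section Calibrated

variable {lam : ℝ} {A : NatExt M → ℝ} {u v : Shift M → ℝ}

/-- A calibrated orbit of `u`, indexed backwards in time: the path that leads from `X (m + k)` to
`X m` in `k` steps realizes equality in `u x' - u x ≤ a`, where `a` is its action. -/
def IsCalibratedOrbit (A : NatExt M → ℝ) (u : Shift M → ℝ) (X : ℕ → Shift M) : Prop :=
  ∀ m k, HasPath A k (X (m + k)) (X m) (u (X m) - u (X (m + k)))

theorem IsCalibrated.exists_isCalibratedOrbit (hu : IsCalibrated A u) (x : Shift M) :
    ∃ X, IsCalibratedOrbit A u X ∧ X 0 = x := by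
  choose g hproj hmin using fun x => (hu.2 x).1
  set X : ℕ → Shift M := fun n => (fun y => tau (g y))^[n] x
  have hX (n : ℕ) : X (n + 1) = tau (g (X n)) := Function.iterate_succ_apply' _ _ _
  refine ⟨X, fun m k => ?_, rfl⟩
  induction k generalizing m with
  | zero => simpa [hproj] using HasPath.start (A := A) (g (X m))
  | succ k ih =>
    have hpath := ih (m + 1)
    rw [hX m, add_right_comm] at hpath
    have hlonger := hpath.step
    rw [hproj] at hlonger
    rw [← add_assoc]
    convert hlonger using 1
    linarith [hmin (X m)]

theorem exists_ge_mem_cylinder_abs_sub_lt {X : ℕ → Shift M} {p : Shift M}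
    (hp : MapClusterPt p atTop X) (hu : Continuous u) (n N : ℕ) {δ : ℝ} (hδ : 0 < δ) :
    ∃ k ≥ N, (X k).1 ∈ PiNat.cylinder p.1 n ∧ |u (X k) - u p| < δ := by
  have hnear : ∀ᶠ y in 𝓝 p, y.1 ∈ PiNat.cylinder p.1 n ∧ |u y - u p| < δ :=
    (eventually_mem_cylinder n p).and
      (Metric.tendsto_nhds.1 hu.continuousAt δ hδ)
  exact Filter.frequently_atTop.1 (hp.frequently hnear) N

theorem IsCalibratedOrbit.mem_nonwandering (h0 : 0 < lam) (h1 : lam < 1) (hu : Continuous u)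
    {X : ℕ → Shift M} (hX : IsCalibratedOrbit A u X) {p : Shift M}
    (hp : MapClusterPt p atTop X) : p ∈ nonwandering lam A := by
  intro ε hε
  obtain ⟨n, hn⟩ := exists_pow_lt_of_lt_one hε h1
  obtain ⟨m, -, hm, hmu⟩ := exists_ge_mem_cylinder_abs_sub_lt hp hu n 0 (half_pos hε)
  obtain ⟨l, hl, hln, hlu⟩ := exists_ge_mem_cylinder_abs_sub_lt hp hu n (m + 1) (half_pos hε)
  obtain ⟨k, rfl⟩ := Nat.exists_eq_add_of_le (show m ≤ l by omega)
  refine ⟨k, by omega, (exists_isPath_iff (P := fun a => |a| < ε)).2 ⟨_, _, _, hX m k,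
    ((seqDist_le_pow_iff h0 h1).2 hln).trans_lt hn,
    ((seqDist_le_pow_iff h0 h1).2 hm).trans_lt hn, ?_⟩⟩
  rw [abs_lt] at *
  constructor <;> linarith

theorem IsCalibratedOrbit.isSource (h0 : 0 < lam) (h1 : lam < 1) (hu : IsSubaction A u)
    {X : ℕ → Shift M} (hX : IsCalibratedOrbit A u X) {p : Shift M}
    (hp : MapClusterPt p atTop X) : IsSource lam A u p (X 0) := by
  rw [hu.isSource_iff h0 h1, peierls_le_coe_iff h0 h1]
  intro n N δ hδ
  obtain ⟨k, hk, hkn, hku⟩ := exists_ge_mem_cylinder_abs_sub_lt hp hu.1 n N hδ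
  have hpath := hX 0 k
  rw [zero_add] at hpath
  exact ⟨k, hk, _, _, _, hpath, hkn, PiNat.self_mem_cylinder _ n, by linarith [(abs_lt.1 hku).1]⟩

theorem IsCalibrated.exists_nonwandering_isSource (h0 : 0 < lam) (h1 : lam < 1)
    (hu : IsCalibrated A u) (x : Shift M) : ∃ p ∈ nonwandering lam A, IsSource lam A u p x := by
  obtain ⟨X, hX, rfl⟩ := hu.exists_isCalibratedOrbit x
  obtain ⟨p, hp⟩ : ∃ p, MapClusterPt p atTop X := exists_clusterPt_of_compactSpace _
  exact ⟨p, hX.mem_nonwandering h0 h1 hu.1.1 hp, hX.isSource h0 h1 hu.1 hp⟩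

theorem IsCalibrated.exists_isLeast_sub (h0 : 0 < lam) (h1 : lam < 1) [Nonempty (Shift M)]
    (hu : IsCalibrated A u) (hv : IsSubaction A v) :
    ∃ m : ℝ, IsLeast (Set.range fun x => u x - v x) m ∧
      IsLeast ((fun x => u x - v x) '' nonwandering lam A) m := by
  obtain ⟨m, ⟨x, rfl⟩, hm⟩ := (isCompact_range (hu.1.1.sub hv.1)).exists_isLeast
    (Set.range_nonempty fun x => u x - v x)
  obtain ⟨p, hp, hpx⟩ := hu.exists_nonwandering_isSource h0 h1 x
  have hple := hpx.sub_le_sub h0 h1 hu.1 hv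
  exact ⟨_, ⟨⟨x, rfl⟩, hm⟩, ⟨p, hp, le_antisymm hple (hm ⟨p, rfl⟩)⟩,
    fun _ hy => hm (Set.image_subset_range _ _ hy)⟩

/-- Among the finitely many `b i` that are sources of `x`, take one minimizing `u - v`.  The points
with a source `b j` of smaller value form a closed set, and a source of `b i` cannot lie in it. -/
theorem IsSubaction.exists_isSource_le_on_isOpen (h0 : 0 < lam) (h1 : lam < 1)
    (hA : HasSummableVariation A) (hu : IsSubaction A u) (hv : IsSubaction A v) {ι : Type*}
    [Finite ι] {b : ι → Shift M} (hb : ∀ q, ∃ i, IsSource lam A u (b i) q) (x : Shift M) :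
    ∃ i, IsSource lam A u (b i) x ∧ ∃ U : Set (Shift M), IsOpen U ∧
      (∀ q, IsSource lam A u q (b i) → q ∈ U) ∧
        ∀ q ∈ U, u (b i) - v (b i) ≤ u q - v q := by
  obtain ⟨i, hix, hmin⟩ := Set.exists_min_image {i | IsSource lam A u (b i) x}
    (fun i => u (b i) - v (b i)) (Set.toFinite _) (hb x)
  let J : Set ι := {j | u (b j) - v (b j) < u (b i) - v (b i)}
  have hclosed : IsClosed (⋃ j ∈ J, {q | IsSource lam A u (b j) q}) :=
    J.toFinite.isClosed_biUnion fun j _ => hu.isClosed_setOf_isSource h0 h1 (b j)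
  refine ⟨i, hix, _, hclosed.isOpen_compl, fun q hqi hq => ?_, fun q hq => ?_⟩
  · obtain ⟨j, hj, hjq⟩ := Set.mem_iUnion₂.1 hq
    have hjx := (hjq.trans h0 h1 hA hu hqi).trans h0 h1 hA hu hix
    exact (hmin j hjx).not_gt hj
  · obtain ⟨j, hjq⟩ := hb q
    have hj : j ∉ J := fun hj => hq (Set.mem_biUnion hj hjq)
    exact (not_lt.1 hj).trans (hjq.sub_le_sub h0 h1 hu hv)

theorem IsCalibrated.isSource_of_not_isLocalMinSet (h0 : 0 < lam) (h1 : lam < 1)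
    (hA : HasSummableVariation A) (hu : IsCalibrated A u) (hv : IsSubaction A v) {ι : Type*}
    [Finite ι] {C : ι → Set (Shift M)} (hC : ∀ i, IsComponent lam A (C i))
    (hΩ : nonwandering lam A = ⋃ i, C i) {i₁ : ι}
    (hloc : ∀ i, i ≠ i₁ → ¬ IsLocalMinSet (fun x => u x - v x) (C i)) {xbar : Shift M}
    (hxbar : xbar ∈ C i₁) (x : Shift M) : IsSource lam A u xbar x := by
  choose b hb using fun i => (hC i).exists_isSource h0 h1 hu.1
  have hsource (q : Shift M) : ∃ i, IsSource lam A u (b i) q := by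
    obtain ⟨p, hp, hpq⟩ := hu.exists_nonwandering_isSource h0 h1 q
    obtain ⟨i, hpi⟩ := Set.mem_iUnion.1 (hΩ ▸ hp)
    exact ⟨i, (hb i p hpi).1.trans h0 h1 hA hu.1 hpq⟩
  obtain ⟨i, hix, U, hU, hbU, hle⟩ := hu.1.exists_isSource_le_on_isOpen h0 h1 hA hv hsource x
  have hmin : IsLocalMinSet (fun x => u x - v x) (C i) :=
    ⟨U, hU, fun p hp => hbU p (hb i p hp).2, fun p hp q hq =>
      ((hb i p hp).2.sub_le_sub h0 h1 hu.1 hv).trans (hle q hq)⟩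
  obtain rfl : i = i₁ := of_not_not fun hi => hloc i hi hmin
  exact (hb i xbar hxbar).2.trans h0 h1 hA hu.1 hix

end Calibrated

end SFT

theorem mainTheorem5_general {s : ℕ} {M : Matrix (Fin s) (Fin s) ℕ} [Nonempty (SFT.Shift M)]
    {lam : ℝ} (hlam0 : 0 < lam) (hlam1 : lam < 1)
    {A : SFT.NatExt M → ℝ} (hA : SFT.HasSummableVariation A)
    {v u : SFT.Shift M → ℝ} (hv : SFT.IsSubaction A v) (hu : SFT.IsCalibrated A u) :
    (∀ C : Set (SFT.Shift M), SFT.IsComponent lam A C →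
      ∀ x ∈ C, ∀ x' ∈ C, u x - v x = u x' - v x') ∧
    (∃ m : ℝ, IsLeast (Set.range fun x => u x - v x) m ∧
      IsLeast ((fun x => u x - v x) '' SFT.nonwandering lam A) m) ∧
    (∀ (ι : Type*) [Finite ι] (C : ι → Set (SFT.Shift M)),
      (∀ i, SFT.IsComponent lam A (C i)) →
      SFT.nonwandering lam A = ⋃ i, C i →
      ∀ i₁ : ι,
        (∀ i, i ≠ i₁ → ¬ SFT.IsLocalMinSet (fun x => u x - v x) (C i)) →
        ∀ xbar ∈ C i₁, ∀ x : SFT.Shift M,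
          (u x : EReal) = (u xbar : EReal) + SFT.peierls lam A xbar x) :=
  ⟨fun _ hC _ hx _ hx' => hC.sub_eq_sub hlam0 hlam1 hu.1 hv hx hx',
    hu.exists_isLeast_sub hlam0 hlam1 hv,
    fun _ _ _ hC hΩ _ hloc _ hxbar x =>
      hu.isSource_of_not_isLocalMinSet hlam0 hlam1 hA hv hC hΩ hloc hxbar x⟩

theorem mainTheorem5 {s : ℕ} (hs : 1 ≤ s) (M : Matrix (Fin s) (Fin s) ℕ)
    (hM : SFT.IsTransitionMatrix M) (hirr : SFT.IsIrreducible M)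
    (lam : ℝ) (hlam0 : 0 < lam) (hlam1 : lam < 1)
    (A : SFT.NatExt M → ℝ) (hA : SFT.IsHolder lam A)
    (v u : SFT.Shift M → ℝ) (hv : SFT.IsSubaction A v) (hu : SFT.IsCalibrated A u) :
    -- the difference is constant on every irreducible component
    (∀ C : Set (SFT.Shift M), SFT.IsComponent lam A C →
      ∀ x ∈ C, ∀ x' ∈ C, u x - v x = u x' - v x') ∧
    -- both minima exist and they are equal
    (∃ m : ℝ, IsLeast (Set.range fun x => u x - v x) m ∧
      IsLeast ((fun x => u x - v x) '' SFT.nonwandering lam A) m) ∧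
    -- finitely many components
    (∀ (r : ℕ) (C : Fin r → Set (SFT.Shift M)),
      (∀ i, SFT.IsComponent lam A (C i)) →
      Pairwise (fun i j => Disjoint (C i) (C j)) →
      SFT.nonwandering lam A = ⋃ i, C i →
      ∀ i₁ : Fin r,
        (∀ i, (∃ x ∈ C i, ∀ x', u x - v x ≤ u x' - v x') ↔ i = i₁) →
        (∀ i, i ≠ i₁ → ¬ SFT.IsLocalMinSet (fun x => u x - v x) (C i)) →
        ∀ xbar ∈ C i₁, ∀ x : SFT.Shift M,
          (u x : EReal) = (u xbar : EReal) + SFT.peierls lam A xbar x) := by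
  have := SFT.nonempty_shift hs (hirr.exists_eq_one hM)
  obtain ⟨hconst, hmin, hsource⟩ :=
    mainTheorem5_general hlam0 hlam1 (hA.hasSummableVariation hlam0 hlam1) hv hu
  exact ⟨hconst, hmin, fun r C hC _ hΩ i₁ _ => hsource (Fin r) C hC hΩ i₁⟩
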